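/- Attach to the pairs $(x,x+1)$, $x\in\mathbb Z$, of neighboring integers independent Poisson processes of signals of rate $1$ on $\mathbb R_{\ge 0}$ (independent exponential clocks of rate $1$). Given a rule for updating pairs of values, a process of configurations on $\mathbb Z$ driven by these clocks evolves as follows: whenever there is a signal at time $t$ at $(x,x+1)$, the pair of values at $(x,x+1)$ at time $t$ is replaced at time $t+0$ by the one given by the rule, and the values do not change otherwise. The multi-type TASEP $\eta_t:\mathbb Z\to\mathbb Z$ has the rule "swap the two values if they are in strictly decreasing order (from left to right), and do nothing otherwise". The totally asymmetric voter model $\nu_t:\mathbb Z\to\mathbb Z$ has the rule $\nu_{t+0}(x)=\nu_t(x+1)$, $\nu_{t+0}(x+1)=\nu_t(x+1)$. The totally asymmetric coalescence process $\xi_t:\mathbb Z\to\{0,1\}$ has the rule $00\to00$, $10\to10$, $01\to10$, $11\to10$. **Proposition.** Let $\eta_t$, $t\ge 0$, be the multi-type TASEP started from $\eta_0(x)=-x$, $x\in\mathbb Z$. For $a,b\in\mathbb Z$ define $$\tilde\nu_t(b)=\min_{x\le b}\eta_t(x),\qquad \tilde\xi_t(a)=\begin{cases}1,&\text{if }\eta_t(x)>\eta_t(a)\text{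 for all }x<a,\\0,&\text{otherwise.}\end{cases}$$ Then, almost surely, the minimum defining $\tilde\nu_t(b)$ is attained for all $t\ge0$ and $b\in\mathbb Z$; the process $\tilde\nu_t$ is a totally asymmetric voter model with initial configuration $\tilde\nu_0(x)=-x$, $x\in\mathbb Z$; and $\tilde\xi_t$ is a totally asymmetric coalescence process with initial configuration $\tilde\xi_0(x)=1$, $x\in\mathbb Z$. Both are driven by the same clocks as $\eta_t$. -/

import Mathlib

open MeasureTheory ProbabilityTheory Filter Topology
open scoped NNReal

namespace VoterTASEP

/-- Independent exponential clocks of rate one, one clock for each pair of neighbouring sites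
`(x, x + 1)`: `τ x n` is the waiting time between the `n`-th and the `(n + 1)`-st signal of the
clock of the pair `(x, x + 1)` (for `n = 0`, the time until the first signal). Thus the signals
of the pairs form independent Poisson processes of rate one on the half-line. -/
structure IsClockFamily {Ω : Type*} [MeasurableSpace Ω] (μ : Measure Ω)
    (τ : ℤ → ℕ → Ω → ℝ) : Prop where
  measurable : ∀ x n, Measurable (τ x n)
  law : ∀ x n, μ.map (τ x n) = expMeasure 1
  indep : iIndepFun (fun p : ℤ × ℕ => τ p.1 p.2) μ

/-- The clock of the pair `(x, x + 1)` gives a signal at time `t`, i.e. `t` is a sum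
`τ x 0 + ⋯ + τ x n` of initial waiting times. -/
def Signal {Ω : Type*} (τ : ℤ → ℕ → Ω → ℝ) (ω : Ω) (x : ℤ) (t : ℝ≥0) : Prop :=
  ∃ n : ℕ, ∑ k ∈ Finset.range (n + 1), τ x k ω = (t : ℝ)

/-- The path `X` of configurations on `ℤ` starts from `c`, and at each signal of a pair
`(x, x + 1)` the values at `x` and `x + 1` are replaced according to the rule `U`; the value at a
site does not change otherwise. As usual `X t` is the configuration just before the update when
there is a signal at time `t`, and the configuration at time `t + 0` is the updated one. -/
structure FollowsUpdates {S : Type*} (U : S × S → S × S) (signal : ℤ → ℝ≥0 → Prop)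
    (c : ℤ → S) (X : ℝ≥0 → ℤ → S) : Prop where
  start : X 0 = c
  const : ∀ (x : ℤ) (s t : ℝ≥0), s ≤ t →
    (∀ r, s ≤ r → r < t → ¬ signal (x - 1) r ∧ ¬ signal x r) → X t x = X s x
  update : ∀ (x : ℤ) (t : ℝ≥0), signal x t →
    ∀ᶠ s in 𝓝[>] t, (X s x, X s (x + 1)) = U (X t x, X t (x + 1))

/-- The random process `X` (with `X t ω x` the value at time `t` and site `x`) is the interacting
particle system with nearest-neighbour update rule `U`, performed at rate one independently for
all pairs `(x, x + 1)` at the signals of the clocks `τ`, started from the deterministic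
configuration `c`. -/
structure IsDrivenBy {Ω : Type*} [MeasurableSpace Ω] (μ : Measure Ω) (τ : ℤ → ℕ → Ω → ℝ)
    {S : Type*} [MeasurableSpace S] (U : S × S → S × S) (c : ℤ → S)
    (X : ℝ≥0 → Ω → ℤ → S) : Prop where
  clocks : IsClockFamily μ τ
  measurable : ∀ t x, Measurable (fun ω => X t ω x)
  follows : ∀ᵐ ω ∂μ, FollowsUpdates U (Signal τ ω) c (fun t => X t ω)

/-- The multi-type TASEP rule: the two values are swapped if they are in strictly decreasing
order, and nothing happens otherwise. -/
def tasepRule (p : ℤ × ℤ) : ℤ × ℤ := if p.2 < p.1 then (p.2, p.1) else p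

/-- The totally asymmetric voter rule: the left voter takes the opinion of its right neighbour. -/
def voterRule (p : ℤ × ℤ) : ℤ × ℤ := (p.2, p.2)

/-- The totally asymmetric coalescence rule:
`00 → 00`, `10 → 10`, `01 → 10`, `11 → 10`. -/
def coalescenceRule : Fin 2 × Fin 2 → Fin 2 × Fin 2
  | (0, 0) => (0, 0)
  | (1, 0) => (1, 0)
  | (0, 1) => (1, 0)
  | (1, 1) => (1, 0)

/-- Multi-type TASEP on `ℤ`. -/
def IsTASEP {Ω : Type*} [MeasurableSpace Ω] (μ : Measure Ω) (τ : ℤ → ℕ → Ω → ℝ)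
    (c : ℤ → ℤ) (η : ℝ≥0 → Ω → ℤ → ℤ) : Prop :=
  IsDrivenBy μ τ tasepRule c η

/-- The totally asymmetric voter model on `ℤ`. -/
def IsVoterModel {Ω : Type*} [MeasurableSpace Ω] (μ : Measure Ω) (τ : ℤ → ℕ → Ω → ℝ)
    (c : ℤ → ℤ) (ν : ℝ≥0 → Ω → ℤ → ℤ) : Prop :=
  IsDrivenBy μ τ voterRule c ν

/-- The totally asymmetric coalescence dynamics on `ℤ`. -/
def IsCoalescence {Ω : Type*} [MeasurableSpace Ω] (μ : Measure Ω) (τ : ℤ → ℕ → Ω → ℝ)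
    (c : ℤ → Fin 2) (ξ : ℝ≥0 → Ω → ℤ → Fin 2) : Prop :=
  IsDrivenBy μ τ coalescenceRule c ξ

/-- The minimal type weakly to the left of `b`. -/
noncomputable def nuTilde (η : ℤ → ℤ) (b : ℤ) : ℤ := sInf (η '' Set.Iic b)

open Classical in
/-- The indicator that every particle strictly to the left of `a` has a larger type than the
particle at `a`. -/
noncomputable def xiTilde (η : ℤ → ℤ) (a : ℤ) : Fin 2 := if ∀ x < a, η a < η x then 1 else 0

end VoterTASEP

namespace VoterTASEP

/-! ### Two auxiliary facts on pair updates -/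

/-! A TASEP update permutes two neighbouring values, so the set of values on `Iic b` can change only
at signals of `(b, b + 1)` (`image_Iic_eq`). After a signal at `(x, x + 1)` the pair is in
nondecreasing order. Hence the minimum up to `x` equals the minimum up to `x + 1`, which that signal
preserved: this is the voter rule (`nuTilde_followsUpdates`). Likewise `xiTilde` marks strict left
records. After the signal `x + 1` is no record, while `x` is one iff the smaller of the two values
beats everything left of `x`, that is, iff `x` or `x + 1` was a record before (`xiTilde_update`).
The half-line is infinite, but almost surely some pair arbitrarily far left is silent up to any
given time. This reduces the argument to finite blocks, where updates come one at a time
(`ae_regularSignals`). -/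

lemma image_eq_of_tasepRule {f g : ℤ → ℤ} {x : ℤ} {s : Set ℤ} (hx : x ∈ s) (hx' : x + 1 ∈ s)
    (h : (g x, g (x + 1)) = tasepRule (f x, f (x + 1)))
    (hne : ∀ z ∈ s, z ≠ x → z ≠ x + 1 → g z = f z) : g '' s = f '' s := by
  unfold tasepRule at h
  split_ifs at h with hlt
  · simp only [Prod.mk.injEq] at h
    ext v
    constructor
    · rintro ⟨z, hz, rfl⟩
      by_cases h1 : z = x
      · exact ⟨x + 1, hx', by rw [h1, h.1]⟩
      by_cases h2 : z = x + 1
      · exact ⟨x, hx, by rw [h2, h.2]⟩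
      exact ⟨z, hz, (hne z hz h1 h2).symm⟩
    · rintro ⟨z, hz, rfl⟩
      by_cases h1 : z = x
      · exact ⟨x + 1, hx', by rw [h1, h.2]⟩
      by_cases h2 : z = x + 1
      · exact ⟨x, hx, by rw [h2, h.1]⟩
      exact ⟨z, hz, hne z hz h1 h2⟩
  · simp only [Prod.mk.injEq] at h
    refine Set.image_congr fun z hz => ?_
    by_cases h1 : z = x
    · rw [h1, h.1]
    by_cases h2 : z = x + 1
    · rw [h2, h.2]
    exact hne z hz h1 h2

lemma tasepRule_fst_le_snd (p : ℤ × ℤ) : (tasepRule p).1 ≤ (tasepRule p).2 := by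
  unfold tasepRule
  split_ifs with h
  · exact h.le
  · exact not_lt.1 h

/-! ### Deterministic analysis of a path -/

/-- Signals which are locally finite at each pair, never simultaneous at two pairs, and absent on
any bounded time interval at some pair arbitrarily far to the left. -/
structure RegularSignals (signal : ℤ → ℝ≥0 → Prop) : Prop where
  finite : ∀ x T, {t | t ≤ T ∧ signal x t}.Finite
  unique : ∀ x y t, signal x t → signal y t → x = y
  barrier : ∀ T b, ∃ y < b, ∀ t ≤ T, ¬ signal y t

namespace RegularSignals

variable {signal : ℤ → ℝ≥0 → Prop}

lemma eventually_not_signal (h : RegularSignals signal) (x : ℤ) (t : ℝ≥0) :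
    ∀ᶠ s in 𝓝 t, ∀ r ∈ Set.uIcc t s, r ≠ t → ¬ signal x r := by
  have h1 : ∀ᶠ r in 𝓝 t, r ≠ t → ¬ signal x r := by
    -- A finite set is closed, so with `t` removed its complement is a neighbourhood of `t`.
    have hf : ({r | r ≤ t + 1 ∧ signal x r} \ {t}).Finite := (h.finite x (t + 1)).sdiff
    have ho := hf.isClosed.isOpen_compl.mem_nhds (x := t) (by simp)
    have hlt : ∀ᶠ r in 𝓝 t, r < t + 1 := eventually_lt_nhds (by simp)
    filter_upwards [ho, hlt] with r hr hr' hne hs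
    exact hr ⟨⟨hr'.le, hs⟩, hne⟩
  have h2 : Tendsto (fun s => Set.uIcc t s) (𝓝 t) (𝓝 t).smallSets :=
    tendsto_const_nhds.uIcc tendsto_id
  exact h2.eventually (eventually_smallSets_forall.2 h1)

lemma eventually_right (h : RegularSignals signal) {x : ℤ} {t : ℝ≥0} (hx : ¬ signal x t) :
    ∀ᶠ s in 𝓝[>] t, ∀ r, t ≤ r → r < s → ¬ signal x r := by
  filter_upwards [nhdsWithin_le_nhds (h.eventually_not_signal x t)] with s hs r htr hrs
  rcases eq_or_ne r t with rfl | hne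
  · exact hx
  · exact hs r (Set.mem_uIcc_of_le htr hrs.le) hne

lemma eventually_left (h : RegularSignals signal) (x : ℤ) (t : ℝ≥0) :
    ∀ᶠ s in 𝓝 t, ∀ r, s ≤ r → r < t → ¬ signal x r := by
  filter_upwards [h.eventually_not_signal x t] with s hs r hsr hrt
  exact hs r (Set.mem_uIcc_of_ge hsr hrt.le) hrt.ne

end RegularSignals

namespace FollowsUpdates

variable {S : Type*} {U : S × S → S × S} {signal : ℤ → ℝ≥0 → Prop} {c : ℤ → S}
  {X : ℝ≥0 → ℤ → S}

lemma eventually_right_eq (hX : FollowsUpdates U signal c X) (h : RegularSignals signal)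
    {z : ℤ} {t : ℝ≥0} (h1 : ¬ signal (z - 1) t) (h2 : ¬ signal z t) :
    ∀ᶠ s in 𝓝[>] t, X s z = X t z := by
  filter_upwards [h.eventually_right h1, h.eventually_right h2, self_mem_nhdsWithin]
    with s hs1 hs2 hts
  exact hX.const z t s (le_of_lt hts) fun r hr hr' => ⟨hs1 r hr hr', hs2 r hr hr'⟩

/-- Left continuity holds even at signal times, because an update at `t` takes effect only after
`t`. -/
lemma eventually_left_eq (hX : FollowsUpdates U signal c X) (h : RegularSignals signal)
    (z : ℤ) (t : ℝ≥0) : ∀ᶠ s in 𝓝[≤] t, X s z = X t z := by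
  filter_upwards [nhdsWithin_le_nhds (h.eventually_left (z - 1) t),
    nhdsWithin_le_nhds (h.eventually_left z t), self_mem_nhdsWithin] with s hs1 hs2 hst
  exact (hX.const z s t hst fun r hr hr' => ⟨hs1 r hr hr', hs2 r hr hr'⟩).symm

end FollowsUpdates

section Path

variable {signal : ℤ → ℝ≥0 → Prop} {c : ℤ → ℤ} {X : ℝ≥0 → ℤ → ℤ}

lemma eventually_right_image_Ioc_eq (hX : FollowsUpdates tasepRule signal c X)
    (h : RegularSignals signal) {y b : ℤ} {t : ℝ≥0} (hy : ¬ signal y t) (hb : ¬ signal b t) :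
    ∀ᶠ s in 𝓝[>] t, X s '' Set.Ioc y b = X t '' Set.Ioc y b := by
  by_cases hex : ∃ x ∈ Set.Ioo y b, signal x t
  · obtain ⟨x, ⟨hyx, hxb⟩, hxt⟩ := hex
    have hne : ∀ᶠ s in 𝓝[>] t, ∀ z ∈ Set.Ioc y b, z ≠ x → z ≠ x + 1 → X s z = X t z := by
      refine (eventually_all_finite (Set.finite_Ioc y b)).2 fun z _ => ?_
      by_cases h1 : z = x
      · exact .of_forall fun s hs => absurd h1 hs
      by_cases h2 : z = x + 1
      · exact .of_forall fun s _ hs => absurd h2 hs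
      filter_upwards [hX.eventually_right_eq h (z := z) (t := t)
        (fun hs => h2 (by linarith [h.unique _ _ _ hs hxt]))
        (fun hs => h1 (h.unique _ _ _ hs hxt))] with s hs _ _ using hs
    filter_upwards [hne, hX.update x t hxt] with s hs hu
    exact image_eq_of_tasepRule ⟨hyx, hxb.le⟩ ⟨by omega, by omega⟩ hu hs
  · push Not at hex
    have hout : ∀ x ∈ Set.Icc y b, ¬ signal x t := by
      rintro x ⟨h1, h2⟩
      rcases h1.eq_or_lt with rfl | h1
      · exact hy
      rcases h2.eq_or_lt with rfl | h2
      · exact hb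
      exact hex x ⟨h1, h2⟩
    have hall : ∀ᶠ s in 𝓝[>] t, ∀ z ∈ Set.Ioc y b, X s z = X t z :=
      (eventually_all_finite (Set.finite_Ioc y b)).2 fun z hz =>
        hX.eventually_right_eq h (hout _ ⟨by linarith [hz.1, Int.add_one_le_iff.2 hz.1],
          by linarith [hz.2]⟩) (hout _ ⟨hz.1.le, hz.2⟩)
    filter_upwards [hall] with s hs using Set.image_congr hs

/-- Between two pairs without signals the dynamics only rearranges the values. -/
lemma image_Ioc_eq (hX : FollowsUpdates tasepRule signal c X) (h : RegularSignals signal)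
    {y b : ℤ} {s t : ℝ≥0} (hst : s ≤ t) (hy : ∀ r, s ≤ r → r < t → ¬ signal y r)
    (hb : ∀ r, s ≤ r → r < t → ¬ signal b r) :
    X t '' Set.Ioc y b = X s '' Set.Ioc y b := by
  -- Equality of images is an equivalence relation on times; by connectedness of `[s, t]` it
  -- suffices that it holds locally around each time.
  refine (isPreconnected_Icc (a := s) (b := t)).induction₂
    (fun r r' => X r '' Set.Ioc y b = X r' '' Set.Ioc y b) (fun r hr => ?_)
    (fun _ _ _ _ _ _ h1 h2 => h1.trans h2) (fun _ _ _ _ h1 => h1.symm)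
    (Set.right_mem_Icc.2 hst) (Set.left_mem_Icc.2 hst)
  have hleft : ∀ᶠ q in 𝓝[≤] r, X r '' Set.Ioc y b = X q '' Set.Ioc y b := by
    filter_upwards [(eventually_all_finite (Set.finite_Ioc y b)).2
      fun z _ => hX.eventually_left_eq h z r] with q hq
    exact (Set.image_congr hq).symm
  -- A boundary signal at the final time `t` is allowed, so only times to its left are compared
  -- there.
  rcases hr.2.eq_or_lt with rfl | hrt
  · exact nhdsWithin_mono r (fun q hq => hq.2) hleft
  · have hright := eventually_right_image_Ioc_eq hX h (hy r hr.1 hrt) (hb r hr.1 hrt)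
    refine nhdsWithin_le_nhds ?_
    rw [← nhdsLE_sup_nhdsGT r]
    exact eventually_sup.2 ⟨hleft, hright.mono fun q hq => hq.symm⟩

/-- The set of values weakly to the left of `b` changes only at the signals of `(b, b + 1)`. -/
lemma image_Iic_eq (hX : FollowsUpdates tasepRule signal c X) (h : RegularSignals signal)
    {b : ℤ} {s t : ℝ≥0} (hst : s ≤ t) (hb : ∀ r, s ≤ r → r < t → ¬ signal b r) :
    X t '' Set.Iic b = X s '' Set.Iic b := by
  -- The barrier depends on `z`: each single value lies in some finite block closed off on the left.
  have key : ∀ z ≤ b, ∃ y < z, X t '' Set.Ioc y b = X s '' Set.Ioc y b := fun z _ => by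
    obtain ⟨y, hyz, hy⟩ := h.barrier t z
    exact ⟨y, hyz, image_Ioc_eq hX h hst (fun r _ hr => hy r hr.le) hb⟩
  apply Set.Subset.antisymm
  · rintro _ ⟨z, hz, rfl⟩
    obtain ⟨y, hyz, hy⟩ := key z hz
    exact Set.image_mono (fun _ hx => hx.2) (hy.subset (Set.mem_image_of_mem _ ⟨hyz, hz⟩))
  · rintro _ ⟨z, hz, rfl⟩
    obtain ⟨y, hyz, hy⟩ := key z hz
    exact Set.image_mono (fun _ hx => hx.2) (hy.superset (Set.mem_image_of_mem _ ⟨hyz, hz⟩))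

/-! ### Running minima and the voter model. -/

lemma bddBelow_image_Iic (hX : FollowsUpdates tasepRule signal (fun x => -x) X)
    (h : RegularSignals signal) (t : ℝ≥0) (b : ℤ) : BddBelow (X t '' Set.Iic b) := by
  obtain ⟨y, -, hy⟩ := h.barrier t b
  have h1 : BddBelow (X t '' Set.Iic y) := by
    rw [image_Iic_eq hX h zero_le (fun r _ hr => hy r hr.le), hX.start]
    refine ⟨-y, ?_⟩
    rintro _ ⟨z, hz, rfl⟩
    exact neg_le_neg hz
  refine (h1.union ((Set.finite_Ioc y b).image (X t)).bddBelow).mono ?_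
  rw [← Set.image_union]
  exact Set.image_mono fun z hz => (le_or_gt z y).imp id fun hyz => ⟨hyz, hz⟩

/-- Boundedness is essential: `sInf` on `ℤ` takes a default value on sets unbounded below. -/
lemma isLeast_nuTilde {f : ℤ → ℤ} {b : ℤ} (h : BddBelow (f '' Set.Iic b)) :
    IsLeast (f '' Set.Iic b) (nuTilde f b) :=
  ⟨Int.csInf_mem (Set.nonempty_Iic.image f) h, fun _ hv => csInf_le h hv⟩

lemma nuTilde_eq_of_le {f : ℤ → ℤ} {x : ℤ} (h : BddBelow (f '' Set.Iic (x + 1)))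
    (hle : f x ≤ f (x + 1)) : nuTilde f x = nuTilde f (x + 1) := by
  have h1 := isLeast_nuTilde h
  refine IsLeast.csInf_eq ⟨?_, fun v hv =>
    h1.2 (Set.image_mono (Set.Iic_subset_Iic.2 (by simp)) hv)⟩
  obtain ⟨z, hz, hzv⟩ := h1.1
  rcases (Set.mem_Iic.1 hz).eq_or_lt with rfl | hlt
  · exact ⟨x, Set.self_mem_Iic, le_antisymm (hle.trans hzv.le)
      (h1.2 ⟨x, by simp, rfl⟩)⟩
  · exact ⟨z, Int.lt_add_one_iff.1 hlt, hzv⟩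

lemma eventually_right_image_Iio_eq (hX : FollowsUpdates tasepRule signal c X)
    (h : RegularSignals signal) {x : ℤ} {t : ℝ≥0} (hx : signal x t) :
    ∀ᶠ s in 𝓝[>] t, X s '' Set.Iio x = X t '' Set.Iio x := by
  have hx' : ¬ signal (x - 1) t := fun hs => by linarith [h.unique _ _ _ hs hx]
  have hI : Set.Iio x = Set.Iic (x - 1) := by
    ext z
    simp
  rw [hI]
  filter_upwards [h.eventually_right hx', self_mem_nhdsWithin] with s hs hts
  exact image_Iic_eq hX h (le_of_lt hts) hs

lemma nuTilde_followsUpdates (hX : FollowsUpdates tasepRule signal (fun x => -x) X)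
    (h : RegularSignals signal) :
    FollowsUpdates voterRule signal (fun x => -x) (fun t => nuTilde (X t)) where
  start := by
    funext b
    rw [hX.start]
    refine IsLeast.csInf_eq ⟨⟨b, Set.self_mem_Iic, rfl⟩, ?_⟩
    rintro _ ⟨z, hz, rfl⟩
    exact neg_le_neg hz
  const b s t hst hsig := by
    simp only [nuTilde]
    rw [image_Iic_eq hX h hst fun r h1 h2 => (hsig r h1 h2).2]
  update x t hx := by
    filter_upwards [eventually_right_image_Iio_eq hX h hx, hX.update x t hx] with s hs hu
    have hpair : X s '' {x, x + 1} = X t '' {x, x + 1} :=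
      image_eq_of_tasepRule (by simp) (by simp) hu fun z hz h1 h2 => by
        rcases hz with hz | hz
        exacts [absurd hz h1, absurd hz h2]
    have hI : Set.Iic (x + 1) = Set.Iio x ∪ {x, x + 1} := by
      ext z
      simp only [Set.mem_Iic, Set.mem_union, Set.mem_Iio, Set.mem_insert_iff,
        Set.mem_singleton_iff]
      omega
    have h1 : nuTilde (X s) (x + 1) = nuTilde (X t) (x + 1) := by
      simp only [nuTilde]
      rw [hI, Set.image_union, Set.image_union, hs, hpair]
    have hle : X s x ≤ X s (x + 1) := by
      have := tasepRule_fst_le_snd (X t x, X t (x + 1))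
      rwa [← hu] at this
    rw [nuTilde_eq_of_le (bddBelow_image_Iic hX h s (x + 1)) hle, h1, voterRule]

/-! ### Left records and the coalescence process. -/

lemma xiTilde_eq_of_image_eq {f g : ℤ → ℤ} {a : ℤ} (ha : g a = f a)
    (h : g '' Set.Iio a = f '' Set.Iio a) : xiTilde g a = xiTilde f a := by
  have key : ∀ f : ℤ → ℤ, ∀ v, (∀ x < a, v < f x) ↔ ∀ w ∈ f '' Set.Iio a, v < w := fun f v => by
    simp
  have hiff : (∀ x < a, g a < g x) ↔ ∀ x < a, f a < f x := by rw [key g, key f, h, ha]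
  unfold xiTilde
  by_cases hall : ∀ x < a, f a < f x
  · rw [if_pos hall, if_pos (hiff.2 hall)]
  · rw [if_neg hall, if_neg (mt hiff.1 hall)]

open Classical in
lemma xiTilde_succ (f : ℤ → ℤ) (x : ℤ) : xiTilde f (x + 1) =
    if f (x + 1) < f x ∧ ∀ z < x, f (x + 1) < f z then 1 else 0 := by
  have : (∀ z < x + 1, f (x + 1) < f z) ↔ f (x + 1) < f x ∧ ∀ z < x, f (x + 1) < f z := by
    refine ⟨fun h => ⟨h x (by simp), fun z hz => h z (by omega)⟩, fun h z hz => ?_⟩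
    rcases (Int.lt_add_one_iff.1 hz).eq_or_lt with rfl | hz
    exacts [h.1, h.2 z hz]
  simp only [xiTilde, this]

lemma xiTilde_update {f g : ℤ → ℤ} {x : ℤ} (hI : g '' Set.Iio x = f '' Set.Iio x)
    (hu : (g x, g (x + 1)) = tasepRule (f x, f (x + 1))) :
    (xiTilde g x, xiTilde g (x + 1)) = coalescenceRule (xiTilde f x, xiTilde f (x + 1)) := by
  classical
  have key : ∀ v, (∀ z < x, v < g z) ↔ ∀ z < x, v < f z := fun v => by
    have key' : ∀ f : ℤ → ℤ, (∀ z < x, v < f z) ↔ ∀ w ∈ f '' Set.Iio x, v < w := fun f => by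
      simp
    rw [key', key', hI]
  have hmono : ∀ v w, v ≤ w → (∀ z < x, w < f z) → ∀ z < x, v < f z :=
    fun v w hvw hw z hz => hvw.trans_lt (hw z hz)
  have hle : ¬ g (x + 1) < g x := by
    have := tasepRule_fst_le_snd (f x, f (x + 1))
    rw [← hu] at this
    exact not_lt.2 this
  rw [xiTilde_succ, xiTilde_succ, if_neg (fun h => hle h.1)]
  unfold xiTilde
  simp only [key]
  unfold tasepRule at hu
  split_ifs at hu with hlt
  all_goals
    simp only [Prod.mk.injEq] at hu
    rw [hu.1]
  · have := hmono _ _ hlt.le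
    by_cases h1 : ∀ z < x, f x < f z
    · rw [if_pos (this h1), if_pos h1, if_pos ⟨hlt, this h1⟩]
      rfl
    · by_cases h2 : ∀ z < x, f (x + 1) < f z
      · rw [if_pos h2, if_neg h1, if_pos ⟨hlt, h2⟩]
        rfl
      · rw [if_neg h2, if_neg h1, if_neg (fun h => h2 h.2)]
        rfl
  · rw [if_neg (c := f (x + 1) < f x ∧ _) (fun h => hlt h.1)]
    by_cases h1 : ∀ z < x, f x < f z
    · rw [if_pos h1]
      rfl
    · rw [if_neg h1]
      rfl

lemma xiTilde_followsUpdates (hX : FollowsUpdates tasepRule signal (fun x => -x) X)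
    (h : RegularSignals signal) :
    FollowsUpdates coalescenceRule signal (fun _ => 1) (fun t => xiTilde (X t)) where
  start := by
    funext b
    rw [hX.start]
    exact if_pos fun x hx => neg_lt_neg hx
  const a s t hst hsig := by
    have hI : Set.Iio a = Set.Iic (a - 1) := by
      ext z
      simp
    refine xiTilde_eq_of_image_eq (hX.const a s t hst hsig) ?_
    rw [hI, image_Iic_eq hX h hst fun r h1 h2 => (hsig r h1 h2).1]
  update x t hx := by
    filter_upwards [eventually_right_image_Iio_eq hX h hx, hX.update x t hx] with s hs hu
    exact xiTilde_update hs hu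

end Path

/-! ### Regularity of the Poisson signals -/

lemma expMeasure_Ioi_ne_zero (c : ℝ) : expMeasure 1 (Set.Ioi c) ≠ 0 := by
  have := isProbabilityMeasure_expMeasure one_pos
  intro h0
  have h1 : (expMeasure 1).real (Set.Iic c) = 1 := by
    rw [← Set.compl_Ioi, probReal_compl_eq_one_sub measurableSet_Ioi, measureReal_def, h0]
    simp
  rw [← cdf_eq_real, cdf_expMeasure_eq one_pos] at h1
  split_ifs at h1
  · linarith [Real.exp_pos (-(1 * c))]
  · exact zero_ne_one h1

lemma expMeasure_Iic_zero : expMeasure 1 (Set.Iic 0) = 0 := by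
  have := isProbabilityMeasure_expMeasure one_pos
  rw [← measureReal_eq_zero_iff, ← cdf_eq_real, cdf_expMeasure_eq one_pos]
  simp

/-- By Fubini: sections of the diagonal are single points, null for an atomless law. -/
lemma ae_ne_of_indepFun {Ω : Type*} [MeasurableSpace Ω] {μ : Measure Ω} [IsFiniteMeasure μ]
    {X Y : Ω → ℝ} (hX : Measurable X) (hY : Measurable Y) (hXY : IndepFun X Y μ)
    (h : ∀ y, μ.map Y {y} = 0) : ∀ᵐ ω ∂μ, X ω ≠ Y ω := by
  have hd : MeasurableSet {p : ℝ × ℝ | p.1 = p.2} := measurableSet_eq_fun measurable_fst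
    measurable_snd
  have h0 : μ.map (fun ω => (X ω, Y ω)) {p : ℝ × ℝ | p.1 = p.2} = 0 := by
    rw [(indepFun_iff_map_prod_eq_prod_map_map hX.aemeasurable hY.aemeasurable).1 hXY,
      Measure.measure_prod_null hd]
    refine .of_forall fun x => ?_
    have : Prod.mk x ⁻¹' {p : ℝ × ℝ | p.1 = p.2} = {x} := by
      ext y
      simp [eq_comm]
    simp only [this, h, Pi.zero_apply]
  rw [Measure.map_apply (hX.prodMk hY) hd] at h0
  rw [ae_iff]
  simpa using h0

namespace IsClockFamily

variable {Ω : Type*} [MeasurableSpace Ω] {μ : Measure Ω} {τ : ℤ → ℕ → Ω → ℝ}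

lemma ae_pos (h : IsClockFamily μ τ) : ∀ᵐ ω ∂μ, ∀ x n, 0 < τ x n ω := by
  refine ae_all_iff.2 fun x => ae_all_iff.2 fun n => ?_
  have h0 := expMeasure_Iic_zero
  rw [← h.law x n, Measure.map_apply (h.measurable x n) measurableSet_Iic] at h0
  rw [ae_iff]
  convert h0 using 2
  ext ω
  simp

/-- Second Borel–Cantelli lemma for independent events of equal positive probability. It serves both
along one clock and across the first waiting times of different clocks. -/
lemma ae_frequently_lt (h : IsClockFamily μ τ) {p : ℕ → ℤ × ℕ} (hp : p.Injective) (c : ℝ) :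
    ∀ᵐ ω ∂μ, ∃ᶠ k in atTop, c < τ (p k).1 (p k).2 ω := by
  have := h.indep.isProbabilityMeasure
  have hm : ∀ k, MeasurableSet (τ (p k).1 (p k).2 ⁻¹' Set.Ioi c) := fun k =>
    h.measurable _ _ measurableSet_Ioi
  have hind : iIndepSet (fun k => τ (p k).1 (p k).2 ⁻¹' Set.Ioi c) μ := by
    rw [iIndepSet_iff_meas_biInter hm]
    intro s
    exact (h.indep.precomp hp).measure_inter_preimage_eq_mul s fun _ _ => measurableSet_Ioi
  have hsum : ∑' k, μ (τ (p k).1 (p k).2 ⁻¹' Set.Ioi c) = ⊤ := by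
    have : ∀ k, μ (τ (p k).1 (p k).2 ⁻¹' Set.Ioi c) = expMeasure 1 (Set.Ioi c) := fun k => by
      rw [← h.law (p k).1 (p k).2, Measure.map_apply (h.measurable _ _) measurableSet_Ioi]
    simp only [this]
    exact ENNReal.tsum_const_eq_top_of_ne_zero (expMeasure_Ioi_ne_zero c)
  have h1 := measure_limsup_eq_one hm hind hsum
  rw [← prob_compl_eq_zero_iff (MeasurableSet.measurableSet_limsup hm)] at h1
  rw [ae_iff]
  convert h1 using 2
  ext ω
  simp [Filter.mem_limsup_iff_frequently_mem]

lemma ae_sum_ne_sum (h : IsClockFamily μ τ) {x y : ℤ} (hxy : x ≠ y) (n m : ℕ) :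
    ∀ᵐ ω ∂μ, ∑ k ∈ Finset.range (n + 1), τ x k ω ≠ ∑ k ∈ Finset.range (m + 1), τ y k ω := by
  have := h.indep.isProbabilityMeasure
  -- Equality of the sums says that `τ x 0` equals row `y` minus the rest of row `x`. The sign puts
  -- this difference into one sum over `B`, independent of the atomless `τ x 0`.
  let w : ℤ × ℕ → ℝ := fun p => if p.1 = x then -1 else 1
  let g : ℤ × ℕ → Ω → ℝ := fun p ω => w p * τ p.1 p.2 ω
  have hgm : ∀ p, Measurable (g p) := fun p => (h.measurable p.1 p.2).const_mul _
  have hg : iIndepFun g μ := h.indep.comp (fun p v => w p * v) fun p => measurable_const_mul _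
  let B : Finset (ℤ × ℕ) := {y} ×ˢ Finset.range (m + 1) ∪ {x} ×ˢ Finset.Ico 1 (n + 1)
  have hB : (x, 0) ∉ B := by simp [B, hxy.symm]
  have hi := (hg.indepFun_finsetSum_of_notMem hgm hB).comp measurable_id measurable_neg
  have hneg : Neg.neg ∘ g (x, 0) = τ x 0 := by
    funext ω
    simp [g, w]
  rw [hneg] at hi
  have hsum : Measurable (∑ p ∈ B, g p) := by
    rw [Finset.sum_fn]
    exact Finset.measurable_sum B fun p _ => hgm p
  have hne := ae_ne_of_indepFun (measurable_id.comp hsum)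
    (h.measurable x 0) hi fun v => by
      rw [h.law, expMeasure, gammaMeasure]
      exact measure_singleton v
  have hdisj : Disjoint (({y} : Finset ℤ) ×ˢ Finset.range (m + 1))
      (({x} : Finset ℤ) ×ˢ Finset.Ico 1 (n + 1)) :=
    Finset.disjoint_product.2 (Or.inl (by simpa using hxy.symm))
  filter_upwards [hne] with ω hω heq
  apply hω
  simp only [Function.comp, id, Finset.sum_apply, B]
  rw [Finset.sum_union hdisj, Finset.sum_product, Finset.sum_product, Finset.sum_singleton,
    Finset.sum_singleton]
  simp only [g, w, if_neg hxy.symm, if_true, one_mul, neg_mul, Finset.sum_neg_distrib]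
  rw [← heq, Finset.range_eq_Ico, Finset.sum_eq_sum_Ico_succ_bot (Nat.succ_pos n)]
  simp

lemma ae_regularSignals (h : IsClockFamily μ τ) : ∀ᵐ ω ∂μ, RegularSignals (Signal τ ω) := by
  have hrow : ∀ᵐ ω ∂μ, ∀ x : ℤ, ∃ᶠ k in atTop, 1 < τ x k ω := ae_all_iff.2 fun x =>
    h.ae_frequently_lt (p := fun k => (x, k)) (fun _ _ hk => (Prod.mk.inj hk).2) 1
  have hcol : ∀ᵐ ω ∂μ, ∀ N : ℕ, ∃ᶠ k : ℕ in atTop, (N : ℝ) < τ (-k) 0 ω := ae_all_iff.2 fun N =>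
    h.ae_frequently_lt (p := fun k => (-k, 0))
      (fun _ _ hk => by simpa using (Prod.mk.inj hk).1) N
  have hne : ∀ᵐ ω ∂μ, ∀ x y : ℤ, x ≠ y → ∀ n m : ℕ,
      ∑ k ∈ Finset.range (n + 1), τ x k ω ≠ ∑ k ∈ Finset.range (m + 1), τ y k ω := by
    simp only [ae_all_iff]
    exact fun x y hxy n m => h.ae_sum_ne_sum hxy n m
  filter_upwards [h.ae_pos, hrow, hcol, hne] with ω hpos hrow hcol hne
  refine ⟨fun x T => ?_, fun x y t => ?_, fun T b => ?_⟩
  -- Infinitely many waiting times exceed 1, so the signal times diverge.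
  · have hns : ¬ Summable fun k => τ x k ω := fun hs =>
      hrow x ((hs.tendsto_atTop_zero.eventually_lt_const one_pos).mono fun k hk => hk.not_gt)
    have htop := (not_summable_iff_tendsto_nat_atTop_of_nonneg fun k => (hpos x k).le).1 hns
    obtain ⟨N, hN⟩ := eventually_atTop.1 (htop.eventually_gt_atTop (T : ℝ))
    refine ((Set.finite_Iio N).image
      fun n => (∑ k ∈ Finset.range (n + 1), τ x k ω).toNNReal).subset ?_
    rintro t ⟨htT, n, hn⟩
    refine ⟨n, ?_, by simp only [hn, Real.toNNReal_coe]⟩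
    by_contra hnN
    have := hN (n + 1) (by simp only [Set.mem_Iio] at hnN; omega)
    rw [hn] at this
    exact absurd htT (not_le.2 (NNReal.coe_lt_coe.1 this))
  · rintro ⟨n, hn⟩ ⟨m, hm⟩
    by_contra hxy
    exact hne x y hxy n m (hn.trans hm.symm)
  · obtain ⟨N, hN⟩ := exists_nat_ge (T : ℝ)
    -- The bound on `k` gives `-k < b`; the first signal of the pair at `-k` comes after `N ≥ T`.
    obtain ⟨k, hk, hkN⟩ := frequently_atTop.1 (hcol N) ((-b).toNat + 1)
    refine ⟨-k, by omega, ?_⟩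
    rintro t htT ⟨n, hn⟩
    have h1 : τ (-k) 0 ω ≤ ∑ j ∈ Finset.range (n + 1), τ (-k) j ω :=
      Finset.single_le_sum (f := fun j => τ (-k) j ω) (fun j _ => (hpos _ j).le) (by simp)
    have h2 : (t : ℝ) ≤ T := NNReal.coe_le_coe.2 htT
    linarith

end IsClockFamily

lemma measurable_nuTilde {Ω : Type*} [MeasurableSpace Ω] {f : Ω → ℤ → ℤ}
    (hf : ∀ x, Measurable fun ω => f ω x) (b : ℤ) : Measurable fun ω => nuTilde (f ω) b :=
  Measurable.sInf (Set.to_countable (Set.Iic b)) fun x _ => hf x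

lemma measurable_xiTilde {Ω : Type*} [MeasurableSpace Ω] {f : Ω → ℤ → ℤ}
    (hf : ∀ x, Measurable fun ω => f ω x) (a : ℤ) : Measurable fun ω => xiTilde (f ω) a := by
  unfold xiTilde
  refine Measurable.ite ?_ measurable_const measurable_const
  simp only [Set.ofPred_forall]
  exact .iInter fun x => .iInter fun _ => measurableSet_lt (hf a) (hf x)

end VoterTASEP

theorem proposition6p1 {Ω : Type*} [MeasurableSpace Ω] (μ : Measure Ω) [IsProbabilityMeasure μ]
    (τ : ℤ → ℕ → Ω → ℝ) (η : ℝ≥0 → Ω → ℤ → ℤ)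
    (hη : VoterTASEP.IsTASEP μ τ (fun x => -x) η) :
    (∀ᵐ ω ∂μ, ∀ (t : ℝ≥0) (b : ℤ),
      IsLeast (η t ω '' Set.Iic b) (VoterTASEP.nuTilde (η t ω) b)) ∧
    VoterTASEP.IsVoterModel μ τ (fun x => -x) (fun t ω => VoterTASEP.nuTilde (η t ω)) ∧
    VoterTASEP.IsCoalescence μ τ (fun _ => 1) (fun t ω => VoterTASEP.xiTilde (η t ω)) := by

  have hreg := hη.clocks.ae_regularSignals
  refine ⟨?_, ⟨hη.clocks, fun t x => VoterTASEP.measurable_nuTilde (hη.measurable t) x, ?_⟩,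
    ⟨hη.clocks, fun t x => VoterTASEP.measurable_xiTilde (hη.measurable t) x, ?_⟩⟩
  · filter_upwards [hreg, hη.follows] with ω hr hX t b
    exact VoterTASEP.isLeast_nuTilde (VoterTASEP.bddBelow_image_Iic hX hr t b)
  · filter_upwards [hreg, hη.follows] with ω hr hX using VoterTASEP.nuTilde_followsUpdates hX hr
  · filter_upwards [hreg, hη.follows] with ω hr hX using VoterTASEP.xiTilde_followsUpdates hX hr
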